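/- Let $p\ge 3$ be an integer, let $\omega_p=e^{2\pi i/p}$, and let $f:\mathbb{C}\to\mathbb{C}$ be the entire function $$f(z)=\sum_{k=0}^{p-1}\exp(\omega_p^k z).$$ Let $V_0=\{x+iy : y=\tan(\pi/p)\,x,\ x>0\}$ and, for $k=0,\dots,p-1$, let $V_k=\omega_p^k V_0$ be the rotation of $V_0$ about the origin by the angle $2k\pi/p$; let $\overline{V_k}=V_k\cup\{0\}$. Then: 1. Every critical point of $f$ (that is, every zero of $f'$) lies in $\bigcup_{k=0}^{p-1}\overline{V_k}$. 2. On each $\overline{V_k}$ the critical points of $f$ are separated from each other by zeros of $f$: if $a\ne b$ are critical points of $f$ in $\overline{V_k}$, then $f$ has a zero in the open segment between $a$ and $b$. 3. Each ray $V_k$ is mapped by $f$ onto the real axis, i.e. $f(V_k)=\mathbb{R}$. 4. All critical values of $f$ are real and non-zero, and along each ray they alternate between the positive and the negative real axis: if $a\neq b$ are critical points of $f$ in $\overline{V_k}$ with no critical point of $f$ strictly between them, then one of $f(a),f(b)$ is positive and the other is negative. -/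

import Mathlib

noncomputable section

namespace ExpSum

/-- The root of unity `ω_p = exp (2 π i / p)`. -/
def omega (p : ℕ) : ℂ := Complex.exp (2 * (Real.pi : ℂ) * Complex.I / (p : ℂ))

/-- The entire function `f(z) = ∑_{k=0}^{p-1} exp (ω_p ^ k z)`. -/
def f (p : ℕ) (z : ℂ) : ℂ := ∑ k ∈ Finset.range p, Complex.exp (omega p ^ k * z)

/-- The open ray `V_0 = {x + i y : y = tan (π / p) x, x > 0}`. -/
def V0 (p : ℕ) : Set ℂ := {z | z.im = Real.tan (Real.pi / p) * z.re ∧ 0 < z.re}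

/-- The open ray `V_k`: the rotation of `V_0` about the origin by the angle `2 k π / p`. -/
def V (p k : ℕ) : Set ℂ := (fun z : ℂ => omega p ^ k * z) '' V0 p

/-- The ray `V_k` together with its endpoint, the origin. -/
def closedV (p k : ℕ) : Set ℂ := insert 0 (V p k)

/-- `z` is a critical point of the entire function `g`. -/
def IsCriticalPoint (g : ℂ → ℂ) (z : ℂ) : Prop := deriv g z = 0

/-- `v` is a critical value of the entire function `g`. -/
def IsCriticalValue (g : ℂ → ℂ) (v : ℂ) : Prop := ∃ z, IsCriticalPoint g z ∧ g z = v

/-- `a` and `b` are distinct critical points of `g` lying in the (convex) set `R`,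
with no critical point of `g` strictly between them. -/
def AreConsecutiveCriticalPoints (g : ℂ → ℂ) (R : Set ℂ) (a b : ℂ) : Prop :=
  a ∈ R ∧ b ∈ R ∧ a ≠ b ∧ IsCriticalPoint g a ∧ IsCriticalPoint g b ∧
    ∀ c ∈ openSegment ℝ a b, ¬ IsCriticalPoint g c

end ExpSum

end

namespace ExpSum

open Complex Filter Topology

/-! Write `F_j` for the `j`-th derivative of `f`; since `ω ^ p = 1`, the sequence is periodic in `j`
with period `p`. The key inequality is that `ψ_j = z F_{j+1} / F_j` has nonnegative imaginary part
whenever `Im z ^ p ≥ 0` and `F_j z ≠ 0` (`im_logDeriv_nonneg`). It holds already for the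
approximations with `(1 + x / N) ^ N` in place of `exp x`, by induction on the exponent: a cyclic
family of planar sign conditions is preserved at each step (`im_conj_mul_approx_nonneg`).

Near a zero, a logarithmic derivative takes values with negative imaginary part just above it. In
the coordinate `log z` this forbids zeros of `F_j` where `Im z ^ p > 0` or `z ^ p > 0`; conjugation
leaves only the origin and the rays `z ^ p < 0` (`pow_neg_of_F_eq_zero`), which are the `V_k`. On
these rays `ψ_j` is real, and a boundary point lemma makes it strictly decreasing away from the
zeros of `F_j` (`re_mul_deriv_logDeriv_neg`).

Hence critical values are nonzero, and `ψ_0`, which vanishes at critical points, cannot do so twice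
without a zero of `f` in between. Rolle-type reasoning gives the alternation of signs. Surjectivity
onto the real line follows from the two dominant exponentials on a ray, whose sum oscillates with
growing amplitude. -/

/-! ### The derivatives of `f` and their periodicity -/

/-- The sum `∑ k < p, ω_p ^ (k j) exp (ω_p ^ k z)`, which is the `j`-th derivative of `f p`. -/
noncomputable def F (p j : ℕ) (z : ℂ) : ℂ :=
  ∑ k ∈ Finset.range p, omega p ^ (k * j) * exp (omega p ^ k * z)

/-- The polynomial approximation of `F p j` obtained by replacing `exp x` by `(1 + ε x) ^ N`. -/
noncomputable def approx (p : ℕ) (ε : ℝ) (N j : ℕ) (z : ℂ) : ℂ :=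
  ∑ k ∈ Finset.range p, omega p ^ (k * j) * (1 + ε * (omega p ^ k * z)) ^ N

theorem F_zero (p : ℕ) : F p 0 = f p := by
  ext z; simp [F, f]

theorem isPrimitiveRoot_omega {p : ℕ} (hp : p ≠ 0) : IsPrimitiveRoot (omega p) p :=
  Complex.isPrimitiveRoot_exp p hp

theorem omega_pow_self {p : ℕ} (hp : p ≠ 0) : omega p ^ p = 1 :=
  (isPrimitiveRoot_omega hp).pow_eq_one

theorem F_add_self {p : ℕ} (hp : p ≠ 0) (j : ℕ) : F p (j + p) = F p j := by
  ext z
  refine Finset.sum_congr rfl fun k _ => ?_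
  rw [mul_add, pow_add, mul_comm k p, pow_mul _ p k, omega_pow_self hp, one_pow, mul_one]

theorem hasDerivAt_F (p j : ℕ) (z : ℂ) : HasDerivAt (F p j) (F p (j + 1) z) z := by
  unfold F
  refine HasDerivAt.fun_sum fun k _ => ?_
  have h := (((hasDerivAt_id z).const_mul (omega p ^ k)).cexp).const_mul (omega p ^ (k * j))
  refine h.congr_deriv ?_
  rw [mul_add, pow_add, mul_one, id, mul_one]; ring

theorem differentiable_F (p j : ℕ) : Differentiable ℂ (F p j) :=
  fun z => (hasDerivAt_F p j z).differentiableAt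

theorem analyticAt_F (p j : ℕ) (z : ℂ) : AnalyticAt ℂ (F p j) z :=
  (differentiable_F p j).analyticAt z

theorem deriv_f (p : ℕ) (z : ℂ) : deriv (f p) z = F p 1 z := by
  rw [← F_zero]; exact (hasDerivAt_F p 0 z).deriv

theorem sum_omega_pow {p : ℕ} (hp : p ≠ 0) (j : ℕ) :
    ∑ k ∈ Finset.range p, omega p ^ (k * j) = if p ∣ j then (p : ℂ) else 0 := by
  have h := isPrimitiveRoot_omega hp
  have e : ∀ k, omega p ^ (k * j) = (omega p ^ j) ^ k := fun k => by rw [← pow_mul, mul_comm]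
  simp_rw [e]
  split_ifs with hj
  · rw [(h.pow_eq_one_iff_dvd j).2 hj]; simp
  · have h1 : omega p ^ j ≠ 1 := fun h' => hj ((h.pow_eq_one_iff_dvd j).1 h')
    rw [geom_sum_eq h1, ← pow_mul, mul_comm, pow_mul, h.pow_eq_one]; simp

/-- Orthogonality of the powers of `ω` isolates the summand `k = 0`. The right-hand side never
vanishes, which is what rules out a common zero. -/
theorem sum_F {p : ℕ} (hp : p ≠ 0) (z : ℂ) :
    ∑ j ∈ Finset.range p, F p j z = p * exp z := by
  unfold F
  rw [Finset.sum_comm]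
  have e : ∀ k, ∑ j ∈ Finset.range p, omega p ^ (k * j) * exp (omega p ^ k * z) =
      (if p ∣ k then (p : ℂ) else 0) * exp (omega p ^ k * z) := fun k => by
    rw [← Finset.sum_mul, ← sum_omega_pow hp]
    simp_rw [mul_comm k]
  simp_rw [e]
  rw [Finset.sum_eq_single_of_mem 0 (by simp; omega)]
  · simp
  · intro k hk hk0
    rw [if_neg, zero_mul]
    exact fun h => absurd (Nat.le_of_dvd (by omega) h) (by simpa using hk)

/-- The functions `F p j` have no common zero. -/
theorem exists_F_ne_zero {p : ℕ} (hp : p ≠ 0) (z : ℂ) : ∃ j < p, F p j z ≠ 0 := by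
  by_contra! h
  have := sum_F hp z
  rw [Finset.sum_eq_zero (fun j hj => h j (by simpa using hj))] at this
  simp [hp, exp_ne_zero] at this

/-! ### The key inequality, by polynomial approximation -/

theorem approx_zero {p : ℕ} (hp : p ≠ 0) (ε : ℝ) (j : ℕ) (z : ℂ) :
    approx p ε 0 j z = if p ∣ j then (p : ℂ) else 0 := by
  simp [approx, sum_omega_pow hp]

theorem approx_succ (p : ℕ) (ε : ℝ) (N j : ℕ) (z : ℂ) :
    approx p ε (N + 1) j z = approx p ε N j z + ε * (z * approx p ε N (j + 1) z) := by
  simp only [approx, Finset.mul_sum, ← Finset.sum_add_distrib]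
  refine Finset.sum_congr rfl fun k _ => ?_
  rw [mul_add k, pow_add, mul_one]; ring

theorem approx_add_self {p : ℕ} (hp : p ≠ 0) (ε : ℝ) (N j : ℕ) (z : ℂ) :
    approx p ε N (j + p) z = approx p ε N j z := by
  refine Finset.sum_congr rfl fun k _ => ?_
  rw [mul_add, pow_add, mul_comm k p, pow_mul _ p k, omega_pow_self hp, one_pow, mul_one]

/-- Put `a_j = z ^ j * approx j`, regarded as planar vectors. Raising the exponent replaces `a_j` by
`a_j + ε a_{j+1}`, so the cross product of `a_k` and `a_l` becomes a nonnegative combination of four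
cross products of the same kind. The range `k ≤ l ≤ k + p` is closed under this because at its ends
the claim is direct: the product is zero for `l = k`, and `a_{k+p} = z ^ p a_k`. -/
theorem im_conj_mul_approx_nonneg {p : ℕ} (hp : p ≠ 0) {z : ℂ} (hz : 0 ≤ (z ^ p).im) {ε : ℝ}
    (hε : 0 ≤ ε) (N k l : ℕ) (hkl : k ≤ l) (hlk : l ≤ k + p) :
    0 ≤ (star (z ^ k * approx p ε N k z) * (z ^ l * approx p ε N l z)).im := by
  have self : ∀ x : ℂ, (star x * x).im = 0 := fun x => by
    simp [mul_comm]
  have scale : ∀ x : ℂ, 0 ≤ (star x * (z ^ p * x)).im := fun x => by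
    have : star x * (z ^ p * x) = ((normSq x : ℝ) : ℂ) * z ^ p := by
      rw [normSq_eq_conj_mul_self]; simp only [starRingEnd_apply]; ring
    rw [this, im_ofReal_mul]; exact mul_nonneg (normSq_nonneg _) hz
  have wrap : ∀ M, 0 ≤ (star (z ^ k * approx p ε M k z) *
      (z ^ (k + p) * approx p ε M (k + p) z)).im := fun M => by
    rw [approx_add_self hp, pow_add]
    convert scale (z ^ k * approx p ε M k z) using 3
    ring
  induction N generalizing k l with
  | zero =>
    rcases hkl.eq_or_lt with rfl | h1
    · exact (self _).ge
    rcases hlk.eq_or_lt with rfl | h2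
    · exact wrap 0
    · rw [approx_zero hp, approx_zero hp]
      -- At exponent zero only indices divisible by `p` survive, and `k < l < k + p` cannot both be
      -- such.
      split_ifs with hk hl <;> try simp
      have := Nat.le_of_dvd (by omega) ((Nat.dvd_sub hl hk))
      omega
  | succ N ih =>
    rcases hkl.eq_or_lt with rfl | h1
    · exact (self _).ge
    rcases hlk.eq_or_lt with rfl | h2
    · exact wrap _
    · have step : ∀ m, z ^ m * approx p ε (N + 1) m z = z ^ m * approx p ε N m z +
          ε * (z ^ (m + 1) * approx p ε N (m + 1) z) := fun m => by
        rw [approx_succ, pow_succ]; ring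
      rw [step, step]
      -- `wrap` depends on `k`, so the generalized induction hypothesis asks for it at each starting
      -- index.
      have w : ∀ k M, 0 ≤ (star (z ^ k * approx p ε M k z) *
          (z ^ (k + p) * approx p ε M (k + p) z)).im := fun k M => by
        rw [approx_add_self hp, pow_add]
        convert scale (z ^ k * approx p ε M k z) using 3
        ring
      have a := ih k l hkl hlk (w k)
      have b := ih k (l + 1) (by omega) (by omega) (w k)
      have c := ih (k + 1) l (by omega) (by omega) (w _)
      have d := ih (k + 1) (l + 1) (by omega) (by omega) (w _)
      generalize z ^ k * approx p ε N k z = A at *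
      generalize z ^ l * approx p ε N l z = B at *
      generalize z ^ (k + 1) * approx p ε N (k + 1) z = C at *
      generalize z ^ (l + 1) * approx p ε N (l + 1) z = D at *
      have : star (A + ε * C) * (B + ε * D) = star A * B + ε * (star A * D) + ε * (star C * B)
          + ε * (ε * (star C * D)) := by
        simp only [star_add, star_mul', RCLike.star_def, conj_ofReal]; ring
      rw [this]
      simp only [add_im, im_ofReal_mul]
      positivity

theorem tendsto_approx (p j : ℕ) (z : ℂ) :
    Tendsto (fun N : ℕ => approx p (1 / (N : ℝ)) N j z) atTop (𝓝 (F p j z)) := by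
  unfold approx F
  refine tendsto_finsetSum _ fun k _ => Tendsto.const_mul _ ?_
  refine (Complex.tendsto_one_add_div_pow_exp (omega p ^ k * z)).congr fun N => ?_
  congr 1
  push_cast
  ring

/-- The case `l = j + 1` of the cyclic inequality: divide by `|z ^ j| ^ 2` and let `N → ∞` with `ε =
1 / N`. Multiplying by `star (F p j z)` instead of dividing by `F p j z` keeps zeros admissible. -/
theorem im_logDeriv_nonneg {p : ℕ} (hp : p ≠ 0) (j : ℕ) {z : ℂ} (hz : 0 ≤ (z ^ p).im) :
    0 ≤ (z * F p (j + 1) z * star (F p j z)).im := by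
  by_cases h0 : z = 0
  · simp [h0]
  have key : ∀ N : ℕ, 0 ≤ (z * approx p (1 / (N : ℝ)) N (j + 1) z *
      star (approx p (1 / (N : ℝ)) N j z)).im := fun N => by
    have h := im_conj_mul_approx_nonneg hp hz (ε := 1 / (N : ℝ)) (by positivity) N j (j + 1)
      (by omega) (by omega)
    generalize approx p (1 / (N : ℝ)) N (j + 1) z = A at *
    generalize approx p (1 / (N : ℝ)) N j z = B at *
    have : star (z ^ j * B) * (z ^ (j + 1) * A) =
        ((normSq (z ^ j) : ℝ) : ℂ) * (z * A * star B) := by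
      rw [normSq_eq_conj_mul_self, star_mul', ← starRingEnd_apply]
      ring
    rw [this, im_ofReal_mul] at h
    exact nonneg_of_mul_nonneg_right h (normSq_pos.2 (pow_ne_zero _ h0))
  refine ge_of_tendsto' (x := atTop) ((continuous_im.tendsto _).comp ?_) key
  exact ((tendsto_approx p (j + 1) z).const_mul z).mul
    ((continuous_star.tendsto _).comp (tendsto_approx p j z))


/-! ### Two local lemmas on analytic functions -/

/-- An analytic function `Φ` for which `Φ' / Φ` has nonnegative imaginary part at the points `ε i`
does not vanish at the origin. -/
theorem ne_zero_of_im_logDeriv_nonneg {Φ : ℂ → ℂ} (hΦ : AnalyticAt ℂ Φ 0)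
    (h0 : ¬ ∀ᶠ ζ in 𝓝 0, Φ ζ = 0)
    (h : ∀ᶠ ε : ℝ in 𝓝[>] 0, 0 ≤ (deriv Φ (ε * I) * star (Φ (ε * I))).im) : Φ 0 ≠ 0 := by
  obtain ⟨n, g, hg, hg0, hΦg⟩ := hΦ.exists_eventuallyEq_pow_smul_nonzero_iff.2 h0
  simp only [sub_zero, smul_eq_mul] at hΦg
  rcases n with _ | n
  · simpa [hΦg.self_of_nhds] using hg0
  exfalso
  have hlim : Tendsto (fun ε : ℝ => (ε : ℂ) * I) (𝓝[>] 0) (𝓝 0) := by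
    have : Continuous fun ε : ℝ => (ε : ℂ) * I := by fun_prop
    simpa using (this.tendsto 0).mono_left nhdsWithin_le_nhds
  have hd : ∀ᶠ ζ in 𝓝 (0 : ℂ), deriv Φ ζ = ζ ^ n * ((n + 1) * g ζ + ζ * deriv g ζ) := by
    filter_upwards [hΦg.eventually_nhds, hg.eventually_analyticAt] with ζ h1 h2
    rw [EventuallyEq.deriv_eq h1,
      ((hasDerivAt_pow (n + 1) ζ).fun_mul h2.differentiableAt.hasDerivAt).deriv]
    rw [Nat.add_sub_cancel]
    push_cast
    ring
  have key : ∀ᶠ ε : ℝ in 𝓝[>] 0,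
      0 ≤ (-I * ((n + 1) * g (ε * I) + ε * I * deriv g (ε * I)) * star (g (ε * I))).im := by
    filter_upwards [h, hlim.eventually hΦg, hlim.eventually hd, self_mem_nhdsWithin]
      with ε h1 h2 h3 (h4 : 0 < ε)
    rw [h2, h3] at h1
    generalize g (ε * I) = a at *
    generalize deriv g (ε * I) = b at *
    -- The conjugate of `ε I` supplies the factor `-I`: to leading order `Φ' / Φ` is `(n + 1) / (ε
    -- I)`, which has negative imaginary part.
    have e : (ε * I) ^ n * ((n + 1) * a + ε * I * b) * star ((ε * I) ^ (n + 1) * a) =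
        ((normSq ((ε * I) ^ n) * ε : ℝ) : ℂ) *
          (-I * ((n + 1) * a + ε * I * b) * star a) := by
      rw [ofReal_mul, normSq_eq_conj_mul_self, star_mul', pow_succ, star_mul', star_mul',
        ← starRingEnd_apply, RCLike.star_def, conj_ofReal, conj_I]
      ring
    rw [e, im_ofReal_mul] at h1
    refine nonneg_of_mul_nonneg_right h1 (mul_pos (normSq_pos.2 ?_) h4)
    exact pow_ne_zero _ (mul_ne_zero (by exact_mod_cast h4.ne') I_ne_zero)
  have lim : Tendsto (fun ε : ℝ =>
      (-I * ((n + 1) * g (ε * I) + ε * I * deriv g (ε * I)) * star (g (ε * I))).im) (𝓝[>] 0)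
      (𝓝 (-I * ((n + 1) * g 0 + 0 * deriv g 0) * star (g 0)).im) := by
    have hg' := hg.continuousAt.tendsto.comp hlim
    have hdg := hg.deriv.continuousAt.tendsto.comp hlim
    exact (continuous_im.tendsto _).comp
      ((tendsto_const_nhds.mul ((hg'.const_mul _).add (hlim.mul hdg))).mul
        ((continuous_star.tendsto _).comp hg'))
  have := ge_of_tendsto lim key
  have e : -I * ((n + 1) * g 0 + 0 * deriv g 0) * star (g 0) =
      ((normSq (g 0) * (n + 1) : ℝ) : ℂ) * (-I) := by
    rw [ofReal_mul, normSq_eq_conj_mul_self, ← starRingEnd_apply]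
    push_cast
    ring
  rw [e, im_ofReal_mul] at this
  have hpos : 0 < normSq (g 0) * (n + 1) := mul_pos (normSq_pos.2 hg0) (by positivity)
  simp at this
  linarith

/-- A boundary point lemma: a nonconstant function that is analytic at the origin, real there, and
maps the upper half-plane near the origin to the closed upper half-plane, has a derivative with
positive real part. -/
theorem re_deriv_pos_of_im_nonneg {h : ℂ → ℂ} (hh : AnalyticAt ℂ h 0) (hr : (h 0).im = 0)
    (hc : ¬ ∀ᶠ ζ in 𝓝 0, h ζ = h 0) (him : ∀ᶠ ζ in 𝓝 (0 : ℂ), 0 < ζ.im → 0 ≤ (h ζ).im) :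
    0 < (deriv h 0).re := by
  have hH : AnalyticAt ℂ (fun ζ => h ζ - h 0) 0 := hh.sub analyticAt_const
  obtain ⟨n, g, hg, hg0, hhg⟩ := hH.exists_eventuallyEq_pow_smul_nonzero_iff.2
    (by simpa only [sub_eq_zero] using hc)
  simp only [sub_zero, smul_eq_mul] at hhg
  have hn : n ≠ 0 := by
    rintro rfl
    exact hg0 (by simpa using hhg.self_of_nhds.symm)
  have dir : ∀ ξ : ℂ, 0 < ξ.im → 0 ≤ (ξ ^ n * g 0).im := fun ξ hξ => by
    have hlim : Tendsto (fun ε : ℝ => (ε : ℂ) * ξ) (𝓝[>] 0) (𝓝 0) := by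
      have : Continuous fun ε : ℝ => (ε : ℂ) * ξ := by fun_prop
      simpa using (this.tendsto 0).mono_left nhdsWithin_le_nhds
    refine ge_of_tendsto (x := 𝓝[>] (0 : ℝ)) ((continuous_im.tendsto _).comp
      ((hg.continuousAt.tendsto.comp hlim).const_mul (ξ ^ n))) ?_
    filter_upwards [hlim.eventually hhg, hlim.eventually him, self_mem_nhdsWithin]
      with ε h1 h2 (h3 : 0 < ε)
    have h4 := h2 (by rw [im_ofReal_mul]; positivity)
    have h5 : (h (ε * ξ)).im = ((ε * ξ) ^ n * g (ε * ξ)).im := by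
      rw [← h1, sub_im, hr, sub_zero]
    rw [h5, mul_pow, mul_assoc, ← ofReal_pow, im_ofReal_mul] at h4
    exact nonneg_of_mul_nonneg_right h4 (by positivity)
  have dir' : ∀ ξ : ℂ, 0 ≤ ξ.im → 0 ≤ (ξ ^ n * g 0).im := fun ξ hξ => by
    have hcont : Continuous fun δ : ℝ => ((ξ + δ * I) ^ n * g 0).im := by fun_prop
    have hlim := (hcont.tendsto 0).mono_left (nhdsWithin_le_nhds (s := Set.Ioi 0))
    simp only [ofReal_zero, zero_mul, add_zero] at hlim
    refine ge_of_tendsto hlim ?_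
    filter_upwards [self_mem_nhdsWithin] with δ (hδ : 0 < δ)
    refine dir _ ?_
    simp
    linarith
  -- Taking `ξ = exp (i t / n)` in the closed upper half-plane, `ξ ^ n` sweeps the angles from `0`
  -- to `n π`. Angles `0` and `π` force `g 0` to be real, and `π / 2` forces it to be positive.
  have rot : ∀ t : ℝ, 0 ≤ t → t ≤ n * Real.pi → 0 ≤ (exp (t * I) * g 0).im := fun t h1 h2 => by
    have hn' : (0 : ℝ) < n := by positivity
    have h3 := dir' (exp ((t / n : ℝ) * I)) (by
      rw [exp_ofReal_mul_I_im]
      exact Real.sin_nonneg_of_nonneg_of_le_pi (by positivity) ((div_le_iff₀' hn').2 h2))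
    rw [← exp_nat_mul] at h3
    convert h3 using 4
    push_cast
    field_simp
  have pi_pos := Real.pi_pos
  have hn1 : (1 : ℝ) ≤ n := by exact_mod_cast Nat.one_le_iff_ne_zero.2 hn
  have r0 := rot 0 le_rfl (by positivity)
  have r1 := rot (Real.pi / 2) (by positivity) (by nlinarith)
  have r2 := rot Real.pi (by positivity) (by nlinarith)
  simp only [ofReal_zero, zero_mul, exp_zero, one_mul] at r0
  rw [ofReal_div, ofReal_ofNat, exp_pi_div_two_mul_I, I_mul_im] at r1
  rw [exp_pi_mul_I, neg_one_mul, neg_im] at r2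
  have hpos : 0 < (g 0).re := by
    refine lt_of_le_of_ne r1 fun h' => hg0 (Complex.ext h'.symm ?_)
    simp only [zero_im]
    linarith
  obtain rfl : n = 1 := by
    -- If `n ≥ 2`, the angle `3 π / 2` is also available and gives `(g 0).re ≤ 0`.
    by_contra hn2
    have hn2' : (2 : ℝ) ≤ n := by exact_mod_cast (by omega : 2 ≤ n)
    have r3 := rot (Real.pi / 2 + Real.pi) (by positivity) (by nlinarith)
    rw [ofReal_add, ofReal_div, ofReal_ofNat, add_mul, exp_add, exp_pi_div_two_mul_I,
      exp_pi_mul_I, mul_neg_one, neg_mul, neg_im, I_mul_im] at r3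
    linarith
  have hd : HasDerivAt (fun ζ => h ζ - h 0) (g 0) 0 := by
    refine HasDerivAt.congr_of_eventuallyEq ?_ hhg
    have := ((hasDerivAt_id (0 : ℂ)).pow 1).fun_mul hg.differentiableAt.hasDerivAt
    simpa using this
  have := (hd.add_const (h 0)).deriv
  simp only [sub_add_cancel] at this
  rwa [this]


/-! ### Conjugation and rotation symmetry -/

theorem approx_star {p : ℕ} (hp : p ≠ 0) (ε : ℝ) (N j : ℕ) (z : ℂ) :
    approx p ε N j (star z) = star (approx p ε N j z) := by
  induction N generalizing j with
  | zero =>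
    rw [approx_zero hp, approx_zero hp]
    split_ifs <;> simp
  | succ N ih => rw [approx_succ, approx_succ, ih, ih]; simp

theorem F_star {p : ℕ} (hp : p ≠ 0) (j : ℕ) (z : ℂ) : F p j (star z) = star (F p j z) := by
  refine tendsto_nhds_unique (tendsto_approx p j (star z)) ?_
  simp_rw [approx_star hp]
  exact (continuous_star.tendsto _).comp (tendsto_approx p j z)

theorem im_logDeriv_eq_zero {p : ℕ} (hp : p ≠ 0) (j : ℕ) {z : ℂ} (hz : (z ^ p).im = 0) :
    (z * F p (j + 1) z * star (F p j z)).im = 0 := by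
  refine le_antisymm ?_ (im_logDeriv_nonneg hp j hz.ge)
  have h := im_logDeriv_nonneg hp j (z := star z) (by simp [← map_pow, hz])
  rw [F_star hp, F_star hp, ← star_mul', ← star_mul'] at h
  simp only [RCLike.star_def, conj_im] at h ⊢
  linarith

theorem f_omega_mul {p : ℕ} (hp : p ≠ 0) (z : ℂ) : f p (omega p * z) = f p z := by
  have h := (Finset.sum_range_succ (fun k => exp (omega p ^ k * z)) p).symm.trans
    (Finset.sum_range_succ' (fun k => exp (omega p ^ k * z)) p)
  rw [omega_pow_self hp, pow_zero] at h
  unfold f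
  simp_rw [← mul_assoc, ← pow_succ]
  exact (add_right_cancel h).symm

theorem f_omega_pow_mul {p : ℕ} (hp : p ≠ 0) (k : ℕ) (z : ℂ) :
    f p (omega p ^ k * z) = f p z := by
  induction k with
  | zero => simp
  | succ k ih => rw [pow_succ', mul_assoc, f_omega_mul hp, ih]

theorem f_eq_of_pow_eq {p : ℕ} (hp : p ≠ 0) {z w : ℂ} (h : z ^ p = w ^ p) : f p z = f p w := by
  by_cases hw : w = 0
  · subst hw
    rw [zero_pow hp] at h
    rw [(pow_eq_zero_iff hp).1 h]
  have : NeZero p := ⟨hp⟩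
  have h1 : (z / w) ^ p = 1 := by rw [div_pow, h, div_self (pow_ne_zero _ hw)]
  obtain ⟨k, -, hk⟩ := (isPrimitiveRoot_omega hp).eq_pow_of_pow_eq_one h1
  rw [← f_omega_pow_mul hp k w, hk, div_mul_cancel₀ _ hw]

/-- When `z ^ p` is real, `z` and its conjugate differ by a power of `ω`, so `f` agrees at both. -/
theorem f_im_eq_zero {p : ℕ} (hp : p ≠ 0) {z : ℂ} (hz : (z ^ p).im = 0) : (f p z).im = 0 := by
  have h1 : f p (star z) = f p z := f_eq_of_pow_eq hp (by
    rw [← star_pow]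
    exact conj_eq_iff_im.2 hz)
  rw [← F_zero, F_star hp, F_zero] at h1
  exact conj_eq_iff_im.1 h1

/-! ### Location of the zeros -/

/-- Local vanishing passes to all higher derivatives, hence by periodicity to all `F p i`, which
have no common zero. -/
theorem not_eventually_F_eq_zero {p : ℕ} (hp : p ≠ 0) (j : ℕ) (z₀ : ℂ) :
    ¬ ∀ᶠ z in 𝓝 z₀, F p j z = 0 := by
  intro h
  have step : ∀ k, ∀ᶠ z in 𝓝 z₀, F p (j + k) z = 0 := fun k => by
    induction k with
    | zero => exact h
    | succ k ih =>
      filter_upwards [ih.eventually_nhds] with z hz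
      rw [← add_assoc, ← (hasDerivAt_F p (j + k) z).deriv,
        EventuallyEq.deriv_eq (f := fun _ => 0) hz, deriv_const]
  have shift : ∀ n i, F p (i + p * n) = F p i := fun n i => by
    induction n with
    | zero => simp
    | succ n ih => rw [Nat.mul_succ, ← add_assoc, F_add_self hp, ih]
  obtain ⟨i, -, hi⟩ := exists_F_ne_zero hp z₀
  refine hi ?_
  have hle : j ≤ i + p * j := le_add_left (Nat.le_mul_of_pos_left j (by omega))
  rw [← shift j, ← Nat.add_sub_cancel' hle]
  exact (step _).self_of_nhds

/-- In the coordinate `z = z₀ exp ζ`, the logarithmic derivative is `z F_{j+1} / F_j`. Moving to `ζ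
= ε I` rotates `z ^ p` by the angle `p ε`, which stays in the closed upper half-plane for small `ε >
0`; a positive real `z₀ ^ p` is allowed because it rotates upwards. -/
theorem F_ne_zero_of_im_nonneg {p : ℕ} (hp : p ≠ 0) (j : ℕ) {z₀ : ℂ} (hz₀ : z₀ ≠ 0)
    (him : 0 ≤ (z₀ ^ p).im) (hre : (z₀ ^ p).im = 0 → 0 < (z₀ ^ p).re) : F p j z₀ ≠ 0 := by
  have hd : ∀ ζ, HasDerivAt (fun ζ => z₀ * exp ζ) (z₀ * exp ζ) ζ := fun ζ =>
    (Complex.hasDerivAt_exp ζ).const_mul z₀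
  have hΦd : ∀ ζ, HasDerivAt (fun ζ => F p j (z₀ * exp ζ))
      (F p (j + 1) (z₀ * exp ζ) * (z₀ * exp ζ)) ζ := fun ζ =>
    (hasDerivAt_F p j _).comp ζ (hd ζ)
  have h := ne_zero_of_im_logDeriv_nonneg (Φ := fun ζ => F p j (z₀ * exp ζ))
    (Differentiable.analyticAt (fun ζ => (hΦd ζ).differentiableAt) 0) ?_ ?_
  · simpa using h
  · intro h0
    refine not_eventually_F_eq_zero hp j z₀ ?_
    have hlog : Tendsto (fun z => log (z / z₀)) (𝓝 z₀) (𝓝 0) := by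
      have : ContinuousAt (fun z => log (z / z₀)) z₀ :=
        (continuousAt_id.div_const z₀).clog (by simp [hz₀])
      simpa [ContinuousAt, div_self hz₀] using this
    filter_upwards [hlog.eventually h0, eventually_ne_nhds hz₀] with z h1 h2
    rwa [exp_log (div_ne_zero h2 hz₀), mul_div_cancel₀ _ hz₀] at h1
  · have hcont : Continuous fun ε : ℝ => ((z₀ ^ p).re * Real.sin (p * ε) +
        (z₀ ^ p).im * Real.cos (p * ε)) := by fun_prop
    have hpos : ∀ᶠ ε : ℝ in 𝓝[>] 0, 0 ≤ (z₀ ^ p).re * Real.sin (p * ε) +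
        (z₀ ^ p).im * Real.cos (p * ε) := by
      rcases him.eq_or_lt with h0 | h0
      · rw [← h0]
        have hlt : ∀ᶠ ε : ℝ in 𝓝[>] 0, ε < 1 / (p : ℝ) :=
          nhdsWithin_le_nhds (eventually_lt_nhds (by positivity))
        filter_upwards [hlt, self_mem_nhdsWithin] with ε h1 (h2 : 0 < ε)
        have h3 : p * ε ≤ Real.pi := by
          rw [lt_div_iff₀' (by positivity)] at h1
          linarith [Real.pi_gt_three]
        have := Real.sin_nonneg_of_nonneg_of_le_pi (by positivity) h3
        have := hre h0.symm
        rw [zero_mul, add_zero]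
        positivity
      · have := (hcont.tendsto 0).eventually (eventually_gt_nhds (b := 0) (by simpa using h0))
        exact nhdsWithin_le_nhds (this.mono fun _ h => h.le)
    filter_upwards [hpos] with ε hε
    rw [(hΦd _).deriv, mul_comm (F p (j + 1) _)]
    refine im_logDeriv_nonneg hp j ?_
    rw [mul_pow, ← exp_nat_mul, ← mul_assoc, ← ofReal_natCast, ← ofReal_mul, mul_im,
      exp_ofReal_mul_I_im, exp_ofReal_mul_I_re]
    exact hε

/-- The nonzero zeros of the derivatives of `f p` lie on the rays where `z ^ p` is negative. -/
theorem pow_neg_of_F_eq_zero {p : ℕ} (hp : p ≠ 0) {j : ℕ} {z : ℂ} (hz : z ≠ 0)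
    (h : F p j z = 0) : (z ^ p).im = 0 ∧ (z ^ p).re < 0 := by
  have hne : z ^ p ≠ 0 := pow_ne_zero p hz
  have hs : F p j (star z) = 0 := by rw [F_star hp, h, star_zero]
  have him : (z ^ p).im = 0 := by
    rcases lt_trichotomy (z ^ p).im 0 with h0 | h0 | h0
    · refine absurd hs (F_ne_zero_of_im_nonneg hp j (star_ne_zero.2 hz) ?_ ?_) <;>
      · rw [← star_pow, RCLike.star_def, conj_im]
        intros
        linarith
    · exact h0
    · exact absurd h (F_ne_zero_of_im_nonneg hp j hz h0.le fun h' => absurd h' h0.ne')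
  refine ⟨him, lt_of_not_ge fun hre => ?_⟩
  refine F_ne_zero_of_im_nonneg hp j hz him.ge (fun _ => lt_of_le_of_ne hre fun h' => ?_) h
  exact hne (Complex.ext h'.symm him)

/-! ### Strict monotonicity of the logarithmic derivative on the rays -/

/-- Differentiating `z F_{j+1} = c F_j` repeatedly gives `z F_{j+k+1} = (c - k) F_{j+k}`. At `k = p`
periodicity returns the original relation with `c - p` in place of `c`. This excludes the constant
case in the boundary point lemma. -/
theorem F_eq_zero_of_logDeriv_const {p : ℕ} (hp : p ≠ 0) (j : ℕ) {z₀ : ℂ} (hz₀ : z₀ ≠ 0) (c : ℂ)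
    (h : ∀ᶠ ζ in 𝓝 (0 : ℂ), z₀ * exp (-ζ) * F p (j + 1) (z₀ * exp (-ζ)) =
      c * F p j (z₀ * exp (-ζ))) : F p j z₀ = 0 := by
  have hd : ∀ ζ, HasDerivAt (fun ζ => z₀ * exp (-ζ)) (-(z₀ * exp (-ζ))) ζ := fun ζ =>
    (((hasDerivAt_id ζ).neg.cexp).const_mul z₀).congr_deriv (by simp)
  have hF : ∀ i ζ, HasDerivAt (fun ζ => F p i (z₀ * exp (-ζ)))
      (F p (i + 1) (z₀ * exp (-ζ)) * -(z₀ * exp (-ζ))) ζ := fun i ζ =>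
    (hasDerivAt_F p i _).comp ζ (hd ζ)
  have step : ∀ k : ℕ, ∀ᶠ ζ in 𝓝 (0 : ℂ), z₀ * exp (-ζ) * F p (j + k + 1) (z₀ * exp (-ζ)) =
      (c - k) * F p (j + k) (z₀ * exp (-ζ)) := fun k => by
    induction k with
    | zero => simpa using h
    | succ k ih =>
      filter_upwards [ih.eventually_nhds] with ζ hζ
      have h1 := EventuallyEq.deriv_eq hζ
      rw [((hd ζ).fun_mul (hF (j + k + 1) ζ)).deriv, ((hF (j + k) ζ).const_mul (c - k)).deriv] at h1
      have hne : z₀ * exp (-ζ) ≠ 0 := mul_ne_zero hz₀ (exp_ne_zero _)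
      simp only [← add_assoc]
      refine mul_left_cancel₀ hne ?_
      push_cast
      linear_combination -h1
  have h1 := (step p).self_of_nhds
  have h2 := h.self_of_nhds
  have e : F p (j + p + 1) = F p (j + 1) := by
    rw [add_right_comm, F_add_self hp]
  rw [e, F_add_self hp, h2] at h1
  simp only [neg_zero, exp_zero, mul_one] at h1
  have : (p : ℂ) * F p j z₀ = 0 := by linear_combination h1
  exact (mul_eq_zero.1 this).resolve_left (by exact_mod_cast hp)

theorem re_mul_deriv_logDeriv_neg {p : ℕ} (hp : p ≠ 0) {j : ℕ} {z₀ : ℂ}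
    (him : (z₀ ^ p).im = 0) (hre : (z₀ ^ p).re < 0) (hF : F p j z₀ ≠ 0) :
    (z₀ * deriv (fun z => z * F p (j + 1) z / F p j z) z₀).re < 0 := by
  set ψ : ℂ → ℂ := fun z => z * F p (j + 1) z / F p j z with hψ
  have hz₀ : z₀ ≠ 0 := by
    rintro rfl
    simp [hp] at hre
  have hψa : AnalyticAt ℂ ψ z₀ :=
    (analyticAt_id.mul (analyticAt_F p (j + 1) z₀)).div (analyticAt_F p j z₀) hF
  have hψim : ∀ z, (ψ z).im = (z * F p (j + 1) z * star (F p j z)).im / normSq (F p j z) := by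
    intro z
    have : ψ z = ((normSq (F p j z))⁻¹ : ℝ) * (z * F p (j + 1) z * star (F p j z)) := by
      simp only [hψ]
      rw [div_eq_mul_inv, inv_def, starRingEnd_apply, ofReal_inv]
      ring
    rw [this, im_ofReal_mul, div_eq_inv_mul]
  have hd : HasDerivAt (fun ζ : ℂ => z₀ * exp (-ζ)) (-z₀) 0 :=
    (((hasDerivAt_id (0 : ℂ)).neg.cexp).const_mul z₀).congr_deriv (by simp)
  have he : AnalyticAt ℂ (fun ζ : ℂ => z₀ * exp (-ζ)) 0 :=
    Differentiable.analyticAt (by fun_prop) 0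
  have h00 : z₀ * exp (-0) = z₀ := by simp
  have hderiv : deriv (fun ζ => ψ (z₀ * exp (-ζ))) 0 = deriv ψ z₀ * -z₀ := by
    have := hψa.differentiableAt.hasDerivAt
    rw [← h00] at this
    simpa [Function.comp_def] using (this.comp (0 : ℂ) hd).deriv
  -- Since `z₀ ^ p` is negative, the substitution `z = z₀ exp (-ζ)` carries small `ζ` with `Im ζ >
  -- 0` to points where `Im z ^ p ≥ 0`. The sign in the exponent is what makes `ψ` decrease.
  have key := re_deriv_pos_of_im_nonneg (h := fun ζ => ψ (z₀ * exp (-ζ)))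
    (AnalyticAt.fun_comp (by simpa using hψa) he) ?_ ?_ ?_
  · rw [hderiv] at key
    rw [mul_comm]
    simpa using key
  · simp only [neg_zero, exp_zero, mul_one]
    rw [hψim, im_logDeriv_eq_zero hp j him, zero_div]
  · intro hc
    refine hF (F_eq_zero_of_logDeriv_const hp j hz₀ (ψ z₀) ?_)
    have hne : ∀ᶠ ζ in 𝓝 (0 : ℂ), F p j (z₀ * exp (-ζ)) ≠ 0 := by
      refine ((analyticAt_F p j _).continuousAt.comp he.continuousAt).eventually_ne ?_
      simpa using hF
    filter_upwards [hc, hne] with ζ h1 h2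
    simp only [neg_zero, exp_zero, mul_one] at h1
    rw [← h1, hψ]
    field_simp
  · have hsmall : ∀ᶠ ζ in 𝓝 (0 : ℂ), ζ.im < 1 / (p : ℝ) :=
      (continuous_im.tendsto 0).eventually (eventually_lt_nhds (by rw [zero_im]; positivity))
    filter_upwards [hsmall] with ζ h1 h2
    rw [hψim]
    refine div_nonneg (im_logDeriv_nonneg hp j ?_) (normSq_nonneg _)
    have h3 : p * ζ.im ≤ Real.pi := by
      rw [lt_div_iff₀' (by positivity)] at h1
      linarith [Real.pi_gt_three]
    have h4 := Real.sin_nonneg_of_nonneg_of_le_pi (by positivity) h3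
    rw [mul_pow, ← exp_nat_mul, mul_im, him, zero_mul, add_zero, exp_im]
    have h5 : ((p : ℂ) * -ζ).im = -(p * ζ.im) := by simp
    rw [h5, Real.sin_neg]
    have := Real.exp_pos ((p : ℂ) * -ζ).re
    nlinarith [mul_nonneg this.le h4]

theorem hasDerivAt_logDeriv (p j : ℕ) {z : ℂ} (hF : F p j z ≠ 0) :
    HasDerivAt (fun z => z * F p (j + 1) z / F p j z)
      (((F p (j + 1) z + z * F p (j + 2) z) * F p j z - z * F p (j + 1) z * F p (j + 1) z) /
        F p j z ^ 2) z := by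
  have h := ((hasDerivAt_id z).fun_mul (hasDerivAt_F p (j + 1) z)).fun_div (hasDerivAt_F p j z) hF
  simpa using h

/-- The zeros of `f p` are simple. -/
theorem F_zero_ne_zero_of_F_one_eq_zero {p : ℕ} (hp : p ≠ 0) {z : ℂ} (h1 : F p 1 z = 0) :
    F p 0 z ≠ 0 := by
  by_cases hz : z = 0
  · subst hz
    simp [F, hp]
  obtain ⟨him, hre⟩ := pow_neg_of_F_eq_zero hp hz h1
  intro h0
  -- If `F p j z ≠ 0`, two consecutive zeros above it would make the derivative of `ψ_j` vanish at
  -- `z`.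
  have step : ∀ j, F p (j + 1) z = 0 → F p (j + 2) z = 0 → F p j z = 0 := fun j h1 h2 => by
    by_contra hF
    have := re_mul_deriv_logDeriv_neg hp him hre hF
    rw [(hasDerivAt_logDeriv p j hF).deriv] at this
    simp [h1, h2] at this
  -- The descent starts at the indices `p` and `p + 1`, which periodicity identifies with `0` and
  -- `1`.
  have all : ∀ k ≤ p, F p (p - k) z = 0 ∧ F p (p - k + 1) z = 0 := fun k => by
    induction k with
    | zero =>
      intro _
      have e0 := F_add_self hp 0
      have e1 := F_add_self hp 1
      rw [zero_add] at e0
      rw [add_comm] at e1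
      exact ⟨by rw [Nat.sub_zero, e0, h0], by rw [Nat.sub_zero, e1, h1]⟩
    | succ k ih =>
      intro hk
      obtain ⟨a, b⟩ := ih (by omega)
      have e : p - k = p - (k + 1) + 1 := by omega
      rw [e] at a b
      exact ⟨step _ a b, a⟩
  obtain ⟨j, hj, hne⟩ := exists_F_ne_zero hp z
  refine hne ?_
  have := (all (p - j) (by omega)).1
  rwa [Nat.sub_sub_self hj.le] at this


/-! ### Zeros and signs along a ray -/

theorem exists_deriv_eq_zero_of_pos {φ φ' : ℝ → ℝ} (hφ : ∀ s, HasDerivAt φ (φ' s) s) {a b c : ℝ}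
    (hc : c ∈ Set.Ioo a b) (ha : 0 < φ a) (hb : 0 < φ b) (h0 : φ c ≤ 0) :
    ∃ m ∈ Set.Ioo a b, φ' m = 0 := by
  have hcont : Continuous φ := continuous_iff_continuousAt.2 fun s => (hφ s).continuousAt
  obtain ⟨m, hm, hmin⟩ := isCompact_Icc.exists_isMinOn (s := Set.Icc a b)
    ⟨c, Set.Ioo_subset_Icc_self hc⟩ hcont.continuousOn
  have hle : φ m ≤ 0 := (hmin (Set.Ioo_subset_Icc_self hc)).trans h0
  have hma : a ≠ m := fun h => by rw [← h] at hle; linarith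
  have hmb : m ≠ b := fun h => by rw [h] at hle; linarith
  have hm' : m ∈ Set.Ioo a b := ⟨lt_of_le_of_ne hm.1 hma, lt_of_le_of_ne hm.2 hmb⟩
  exact ⟨m, hm', (hmin.isLocalMin (Icc_mem_nhds hm'.1 hm'.2)).hasDerivAt_eq_zero (hφ m)⟩

theorem hasDerivAt_mul_dir (v : ℂ) (s : ℝ) : HasDerivAt (fun s : ℝ => (s : ℂ) * v) v s := by
  simpa using (Complex.ofRealCLM.hasDerivAt (x := s)).mul_const v

theorem im_mul_dir_pow {p : ℕ} {v : ℂ} (hv : v ^ p = -1) (s : ℝ) : ((s * v) ^ p).im = 0 := by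
  rw [mul_pow, hv, ← ofReal_pow, mul_neg_one, neg_im, ofReal_im, neg_zero]

theorem re_mul_dir_pow {p : ℕ} {v : ℂ} (hv : v ^ p = -1) {s : ℝ} (hs : 0 < s) :
    ((s * v) ^ p).re < 0 := by
  rw [mul_pow, hv, ← ofReal_pow, mul_neg_one, neg_re, ofReal_re]
  exact neg_neg_of_pos (pow_pos hs p)

theorem f_mul_dir_eq_re {p : ℕ} (hp : p ≠ 0) {v : ℂ} (hv : v ^ p = -1) (s : ℝ) :
    f p (s * v) = ((f p (s * v)).re : ℂ) :=
  Complex.ext rfl (by simpa using f_im_eq_zero hp (im_mul_dir_pow hv s))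

theorem hasDerivAt_f_mul_dir_re (p : ℕ) (v : ℂ) (s : ℝ) :
    HasDerivAt (fun s : ℝ => (f p (s * v)).re) (F p 1 (s * v) * v).re s := by
  have h1 : HasDerivAt (fun s : ℝ => f p (s * v)) (F p 1 (s * v) * v) s := by
    rw [← F_zero]
    exact (hasDerivAt_F p 0 (s * v)).comp s (hasDerivAt_mul_dir v s)
  exact (Complex.reCLM.hasFDerivAt.comp_hasDerivAt s h1)

theorem hasDerivAt_f_mul_dir_im (p : ℕ) (v : ℂ) (s : ℝ) :
    HasDerivAt (fun s : ℝ => (f p (s * v)).im) (F p 1 (s * v) * v).im s := by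
  have h1 : HasDerivAt (fun s : ℝ => f p (s * v)) (F p 1 (s * v) * v) s := by
    rw [← F_zero]
    exact (hasDerivAt_F p 0 (s * v)).comp s (hasDerivAt_mul_dir v s)
  exact (Complex.imCLM.hasFDerivAt.comp_hasDerivAt s h1)

/-- As `f` is real on the whole line through `v`, its derivative along that line has no imaginary
part. -/
theorem F_one_eq_zero_of_re_eq_zero {p : ℕ} (hp : p ≠ 0) {v : ℂ} (hv : v ^ p = -1) {s : ℝ}
    (h : (F p 1 (s * v) * v).re = 0) : F p 1 (s * v) = 0 := by
  have h1 := hasDerivAt_f_mul_dir_im p v s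
  simp_rw [f_im_eq_zero hp (im_mul_dir_pow hv _)] at h1
  have h2 : F p 1 (s * v) * v = 0 := Complex.ext h (h1.unique (hasDerivAt_const s 0))
  refine (mul_eq_zero.1 h2).resolve_right ?_
  rintro rfl
  rw [zero_pow hp] at hv
  simp at hv

/-- Zeros of `f p` separate its critical points on a ray. -/
theorem exists_zero_between {p : ℕ} (hp : p ≠ 0) {v : ℂ} (hv : v ^ p = -1) {a b : ℝ}
    (ha : 0 ≤ a) (hab : a < b) (hFa : F p 1 (a * v) = 0) (hFb : F p 1 (b * v) = 0) :
    ∃ c ∈ Set.Ioo a b, f p (c * v) = 0 := by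
  by_contra! hne
  rw [← F_zero] at hne
  have hne' : ∀ c ∈ Set.Icc a b, F p 0 (c * v) ≠ 0 := fun c hc => by
    rcases hc.1.eq_or_lt with rfl | h1
    · exact F_zero_ne_zero_of_F_one_eq_zero hp hFa
    rcases hc.2.eq_or_lt with rfl | h2
    · exact F_zero_ne_zero_of_F_one_eq_zero hp hFb
    exact hne c ⟨h1, h2⟩
  set ψ : ℂ → ℂ := fun z => z * F p (0 + 1) z / F p 0 z with hψ
  have hd : ∀ c ∈ Set.Icc a b,
      HasDerivAt (fun s : ℝ => (ψ (s * v)).re) (deriv ψ (c * v) * v).re c := fun c hc => by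
    have h1 : HasDerivAt ψ (deriv ψ (c * v)) (c * v) :=
      (hasDerivAt_logDeriv p 0 (hne' c hc)).differentiableAt.hasDerivAt
    have h2 : HasDerivAt (fun s : ℝ => ψ (s * v)) (deriv ψ (c * v) * v) c :=
      HasDerivAt.comp (h₂ := ψ) c h1 (hasDerivAt_mul_dir v c)
    exact (Complex.reCLM.hasFDerivAt.comp_hasDerivAt c h2)
  have hanti : StrictAntiOn (fun s : ℝ => (ψ (s * v)).re) (Set.Icc a b) := by
    refine strictAntiOn_of_deriv_neg (convex_Icc a b)
      (fun c hc => (hd c hc).continuousAt.continuousWithinAt) fun c hc => ?_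
    rw [interior_Icc] at hc
    have hc' := Set.Ioo_subset_Icc_self hc
    have hc0 : 0 < c := ha.trans_lt hc.1
    rw [(hd c hc').deriv]
    have h1 := re_mul_deriv_logDeriv_neg hp (im_mul_dir_pow hv c) (re_mul_dir_pow hv hc0)
      (hne' c hc')
    rw [mul_assoc, re_ofReal_mul, mul_comm v] at h1
    exact neg_of_mul_neg_right h1 hc0.le
  -- `ψ` vanishes at both endpoints because `F p 1` does.
  have := hanti ⟨le_rfl, hab.le⟩ ⟨hab.le, le_rfl⟩ hab
  simp [hψ, hFa, hFb] at this

/-- The values of `f p` at consecutive critical points on a ray have opposite signs. -/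
theorem sign_change_of_consecutive {p : ℕ} (hp : p ≠ 0) {v : ℂ} (hv : v ^ p = -1) {a b : ℝ}
    (ha : 0 ≤ a) (hab : a < b) (hFa : F p 1 (a * v) = 0) (hFb : F p 1 (b * v) = 0)
    (hne : ∀ c ∈ Set.Ioo a b, F p 1 (c * v) ≠ 0) :
    (0 < (f p (a * v)).re ∧ (f p (b * v)).re < 0) ∨
      ((f p (a * v)).re < 0 ∧ 0 < (f p (b * v)).re) := by
  obtain ⟨c, hc, hc0⟩ := exists_zero_between hp hv ha hab hFa hFb
  have hre : ∀ s : ℝ, F p 1 (s * v) = 0 → (f p (s * v)).re ≠ 0 := fun s hs h => by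
    have := F_zero_ne_zero_of_F_one_eq_zero hp hs
    rw [F_zero, f_mul_dir_eq_re hp hv, h] at this
    simp at this
  rcases (hre a hFa).lt_or_gt with h1 | h1 <;> rcases (hre b hFb).lt_or_gt with h2 | h2
  · obtain ⟨m, hm, hm0⟩ := exists_deriv_eq_zero_of_pos
      (fun s => (hasDerivAt_f_mul_dir_re p v s).fun_neg) hc (by simpa using h1) (by simpa using h2)
      (by simp [hc0])
    exact absurd (F_one_eq_zero_of_re_eq_zero hp hv (neg_eq_zero.1 hm0)) (hne m hm)
  · exact .inr ⟨h1, h2⟩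
  · exact .inl ⟨h1, h2⟩
  · obtain ⟨m, hm, hm0⟩ := exists_deriv_eq_zero_of_pos (hasDerivAt_f_mul_dir_re p v) hc h1 h2
      (by simp [hc0])
    exact absurd (F_one_eq_zero_of_re_eq_zero hp hv hm0) (hne m hm)

/-! ### The rays as the locus where `z ^ p` is negative -/

/-- The direction `exp (i π / p)` of the ray `V_0`. -/
noncomputable def dir (p : ℕ) : ℂ := exp ((Real.pi / p : ℝ) * I)

theorem dir_pow {p : ℕ} (hp : p ≠ 0) : dir p ^ p = -1 := by
  rw [dir, ← exp_nat_mul, ← exp_pi_mul_I]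
  congr 1
  push_cast
  field_simp

theorem omega_pow_mul_dir (p k : ℕ) :
    omega p ^ k * dir p = exp (((2 * k + 1) * (Real.pi / p) : ℝ) * I) := by
  rw [dir, omega, ← exp_nat_mul, ← exp_add]
  congr 1
  push_cast
  ring

theorem omega_pow_mul_dir_pow {p : ℕ} (hp : p ≠ 0) (k : ℕ) : (omega p ^ k * dir p) ^ p = -1 := by
  rw [mul_pow, dir_pow hp, ← pow_mul, mul_comm k, pow_mul, omega_pow_self hp]
  simp

theorem cos_pi_div_pos {p : ℕ} (hp : 3 ≤ p) : 0 < Real.cos (Real.pi / p) := by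
  have hp' : (3 : ℝ) ≤ p := by exact_mod_cast hp
  have h0 : 0 < Real.pi / p := by positivity
  refine Real.cos_pos_of_mem_Ioo ⟨by linarith [Real.pi_pos], ?_⟩
  exact div_lt_div_of_pos_left Real.pi_pos (by norm_num) (by linarith)

theorem mem_V0_iff {p : ℕ} (hp : 3 ≤ p) (z : ℂ) : z ∈ V0 p ↔ ∃ s : ℝ, 0 < s ∧ z = s * dir p := by
  have hc := cos_pi_div_pos hp
  constructor
  · rintro ⟨h1, h2⟩
    refine ⟨z.re / Real.cos (Real.pi / p), by positivity, Complex.ext ?_ ?_⟩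
    · rw [re_ofReal_mul, dir, exp_ofReal_mul_I_re]
      field_simp
    · rw [im_ofReal_mul, dir, exp_ofReal_mul_I_im, h1, Real.tan_eq_sin_div_cos]
      field_simp
  · rintro ⟨s, hs, rfl⟩
    simp only [V0, Set.mem_ofPred_eq]
    rw [re_ofReal_mul, im_ofReal_mul, dir, exp_ofReal_mul_I_re, exp_ofReal_mul_I_im,
      Real.tan_eq_sin_div_cos]
    refine ⟨by field_simp, by positivity⟩

theorem mem_V_iff {p : ℕ} (hp : 3 ≤ p) (k : ℕ) (z : ℂ) :
    z ∈ V p k ↔ ∃ s : ℝ, 0 < s ∧ z = s * (omega p ^ k * dir p) := by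
  simp only [V, Set.mem_image, mem_V0_iff hp]
  constructor
  · rintro ⟨_, ⟨s, hs, rfl⟩, rfl⟩
    exact ⟨s, hs, by ring⟩
  · rintro ⟨s, hs, rfl⟩
    exact ⟨_, ⟨s, hs, rfl⟩, by ring⟩

theorem mem_closedV_iff {p : ℕ} (hp : 3 ≤ p) (k : ℕ) (z : ℂ) :
    z ∈ closedV p k ↔ ∃ s : ℝ, 0 ≤ s ∧ z = s * (omega p ^ k * dir p) := by
  rw [closedV, Set.mem_insert_iff, mem_V_iff hp]
  constructor
  · rintro (rfl | ⟨s, hs, rfl⟩)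
    · exact ⟨0, le_rfl, by simp⟩
    · exact ⟨s, hs.le, rfl⟩
  · rintro ⟨s, hs, rfl⟩
    rcases hs.eq_or_lt with rfl | hs
    · simp
    · exact .inr ⟨s, hs, rfl⟩

theorem mem_V_of_pow_neg {p : ℕ} (hp : 3 ≤ p) {z : ℂ} (him : (z ^ p).im = 0)
    (hre : (z ^ p).re < 0) : ∃ k < p, z ∈ V p k := by
  have hp0 : p ≠ 0 := by omega
  have : NeZero p := ⟨hp0⟩
  have hz : z ≠ 0 := by
    rintro rfl
    simp [hp0] at hre
  have hd : dir p ≠ 0 := exp_ne_zero _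
  have hn : (‖z‖ : ℂ) ≠ 0 := by simpa using hz
  have hpow : z ^ p = -(‖z‖ : ℂ) ^ p := by
    have h1 : z ^ p = ((z ^ p).re : ℂ) := Complex.ext rfl (by simpa using him)
    have h2 : ‖z‖ ^ p = -(z ^ p).re := by
      rw [← norm_pow, h1, ofReal_re, norm_real, Real.norm_of_nonpos hre.le]
    rw [← ofReal_pow, h2, h1]
    simp
  have h1 : (z / (‖z‖ * dir p)) ^ p = 1 := by
    rw [div_pow, mul_pow, dir_pow hp0, hpow, mul_neg_one, div_self]
    exact neg_ne_zero.2 (pow_ne_zero _ hn)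
  obtain ⟨k, hk, hk'⟩ := (isPrimitiveRoot_omega hp0).eq_pow_of_pow_eq_one h1
  refine ⟨k, hk, (mem_V_iff hp k z).2 ⟨‖z‖, norm_pos_iff.2 hz, ?_⟩⟩
  rw [hk']
  field_simp

theorem mem_openSegment_mul {a b c : ℝ} (hc : c ∈ Set.Ioo a b) (v : ℂ) :
    (c * v : ℂ) ∈ openSegment ℝ (a * v : ℂ) (b * v) := by
  rw [← openSegment_eq_Ioo (hc.1.trans hc.2)] at hc
  obtain ⟨α, β, hα, hβ, h, rfl⟩ := hc
  refine ⟨α, β, hα, hβ, h, ?_⟩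
  simp only [real_smul, smul_eq_mul, ofReal_add, ofReal_mul]
  ring

/-! ### Growth and oscillation along a ray -/

theorem exp_mul_dir_re (p k : ℕ) (s : ℝ) :
    (exp (omega p ^ k * (s * dir p))).re =
      Real.exp (s * Real.cos ((2 * k + 1) * (Real.pi / p))) *
        Real.cos (s * Real.sin ((2 * k + 1) * (Real.pi / p))) := by
  have : omega p ^ k * (s * dir p) = s * (omega p ^ k * dir p) := by ring
  rw [this, omega_pow_mul_dir, exp_re, re_ofReal_mul, im_ofReal_mul, exp_ofReal_mul_I_re,
    exp_ofReal_mul_I_im]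

/-- These angles lie in `[3π/p, 2π - 3π/p]`, where the cosine is largest at the ends. -/
theorem cos_odd_mul_le {p k : ℕ} (hk : 1 ≤ k) (hkp : k + 2 ≤ p) :
    Real.cos ((2 * k + 1) * (Real.pi / p)) ≤ Real.cos (3 * (Real.pi / p)) := by
  have hp : (0 : ℝ) < p := by exact_mod_cast (by omega : 0 < p)
  have hk' : (1 : ℝ) ≤ k := by exact_mod_cast hk
  have hkp' : (k : ℝ) + 2 ≤ p := by exact_mod_cast hkp
  have hx : 0 < Real.pi / p := by positivity
  have hpx : p * (Real.pi / p) = Real.pi := by field_simp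
  generalize Real.pi / p = x at *
  rcases le_total ((2 * k + 1) * x) Real.pi with h | h
  · exact Real.cos_le_cos_of_nonneg_of_le_pi (by positivity) h (by nlinarith)
  · rw [← Real.cos_two_pi_sub]
    exact Real.cos_le_cos_of_nonneg_of_le_pi (by positivity) (by linarith) (by nlinarith)

/-- The summands `k = 0` and `k = p - 1` are conjugate and give the main term; each of the other `p
- 2` is bounded by the next largest exponential. -/
theorem abs_f_mul_dir_sub_le {p : ℕ} (hp : 3 ≤ p) {s : ℝ} (hs : 0 ≤ s) :
    |(f p (s * dir p)).re - 2 * (Real.exp (s * Real.cos (Real.pi / p)) *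
      Real.cos (s * Real.sin (Real.pi / p)))| ≤ p * Real.exp (s * Real.cos (3 * (Real.pi / p))) := by
  obtain ⟨q, rfl⟩ : ∃ q, p = q + 1 + 1 + 1 := ⟨p - 3, by omega⟩
  set x := Real.pi / ((q + 1 + 1 + 1 : ℕ) : ℝ) with hx
  have hlast : (2 * ((q + 1 + 1 : ℕ) : ℝ) + 1) * x = 2 * Real.pi - x := by
    rw [hx]
    push_cast
    field_simp
    ring
  have hsum : (f (q + 1 + 1 + 1) (s * dir (q + 1 + 1 + 1))).re -
      2 * (Real.exp (s * Real.cos x) * Real.cos (s * Real.sin x)) =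
      ∑ k ∈ Finset.range (q + 1), Real.exp (s * Real.cos ((2 * (k + 1 : ℕ) + 1) * x)) *
        Real.cos (s * Real.sin ((2 * (k + 1 : ℕ) + 1) * x)) := by
    rw [f, re_sum]
    simp_rw [exp_mul_dir_re, ← hx]
    rw [Finset.sum_range_succ, Finset.sum_range_succ', hlast, Real.cos_two_pi_sub,
      Real.sin_two_pi_sub, mul_neg, Real.cos_neg]
    simp only [Nat.cast_zero, mul_zero, zero_add, one_mul]
    ring
  rw [hsum]
  calc _ ≤ ∑ k ∈ Finset.range (q + 1), Real.exp (s * Real.cos (3 * x)) := by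
        refine (Finset.abs_sum_le_sum_abs _ _).trans (Finset.sum_le_sum fun k hk => ?_)
        rw [abs_mul, Real.abs_exp]
        have hk' := Finset.mem_range.1 hk
        have := cos_odd_mul_le (p := q + 1 + 1 + 1) (k := k + 1) (by omega) (by omega)
        rw [← hx] at this
        calc _ ≤ Real.exp (s * Real.cos ((2 * (k + 1 : ℕ) + 1) * x)) * 1 := by
              gcongr
              exact Real.abs_cos_le_one _
          _ ≤ _ := by
              rw [mul_one]
              gcongr
    _ ≤ _ := by
        rw [Finset.sum_const, Finset.card_range, nsmul_eq_mul]
        gcongr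
        omega

theorem tendsto_exp_sub_exp {C c : ℝ} (hC : 0 < C) (hcC : c < C) (m : ℝ) :
    Tendsto (fun s => 2 * Real.exp (s * C) - m * Real.exp (s * c)) atTop atTop := by
  have h1 : Tendsto (fun s => Real.exp (s * C)) atTop atTop :=
    Real.tendsto_exp_atTop.comp (tendsto_id.atTop_mul_const hC)
  have h2 : Tendsto (fun s => 2 - m * Real.exp (s * (c - C))) atTop (𝓝 (2 - m * 0)) :=
    tendsto_const_nhds.sub ((Real.tendsto_exp_atBot.comp
      (tendsto_id.atTop_mul_const_of_neg (by linarith))).const_mul m)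
  refine (h1.atTop_mul_pos (by norm_num) h2).congr fun s => ?_
  rw [mul_sub s, Real.exp_sub]
  field_simp

theorem exists_f_mul_dir_large {p : ℕ} (hp : 3 ≤ p) (M : ℝ) :
    (∃ s : ℝ, 0 < s ∧ M ≤ (f p (s * dir p)).re) ∧
      ∃ s : ℝ, 0 < s ∧ (f p (s * dir p)).re ≤ -M := by
  have hp' : (3 : ℝ) ≤ p := by exact_mod_cast hp
  have hpi := Real.pi_pos
  have h3 : 3 * (Real.pi / p) ≤ Real.pi := by
    rw [← mul_div_assoc, div_le_iff₀ (by positivity)]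
    nlinarith
  have hx : 0 < Real.pi / p := by positivity
  have hcC : Real.cos (3 * (Real.pi / p)) < Real.cos (Real.pi / p) :=
    Real.cos_lt_cos_of_nonneg_of_le_pi hx.le h3 (by linarith)
  have hsin : 0 < Real.sin (Real.pi / p) := Real.sin_pos_of_pos_of_lt_pi hx (by linarith)
  have hlim := (tendsto_exp_sub_exp (cos_pi_div_pos hp) hcC p).comp
    ((tendsto_natCast_atTop_atTop (R := ℝ)).atTop_mul_const
      (show 0 < Real.pi / Real.sin (Real.pi / p) by positivity))
  obtain ⟨N, hN⟩ := (hlim.eventually_ge_atTop M).exists_forall_of_atTop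
  -- At these `s` the main cosine equals `(-1) ^ n`; even `n` yields large positive values and odd
  -- `n` large negative ones.
  have bound : ∀ n : ℕ, 0 < n → ∃ s : ℝ, 0 < s ∧ s * Real.sin (Real.pi / p) = n * Real.pi ∧
      s = n * (Real.pi / Real.sin (Real.pi / p)) := fun n hn =>
    ⟨n * (Real.pi / Real.sin (Real.pi / p)), by positivity, by field_simp, rfl⟩
  constructor
  · obtain ⟨s, hs, h1, h2⟩ := bound (2 * (N + 1)) (by omega)
    refine ⟨s, hs, ?_⟩
    have h3 := hN (2 * (N + 1)) (by omega)
    have h4 := (abs_le.1 (abs_f_mul_dir_sub_le hp hs.le)).1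
    simp only [Function.comp_apply, ← h2] at h3
    rw [h1, Real.cos_nat_mul_pi, pow_mul, neg_one_sq, one_pow, mul_one] at h4
    linarith
  · obtain ⟨s, hs, h1, h2⟩ := bound (2 * N + 1) (by omega)
    refine ⟨s, hs, ?_⟩
    have h3 := hN (2 * N + 1) (by omega)
    have h4 := (abs_le.1 (abs_f_mul_dir_sub_le hp hs.le)).2
    simp only [Function.comp_apply, ← h2] at h3
    rw [h1, Real.cos_nat_mul_pi, pow_succ, pow_mul, neg_one_sq, one_pow, one_mul] at h4
    linarith

theorem f_image_V {p : ℕ} (hp : 3 ≤ p) (k : ℕ) :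
    f p '' V p k = Set.range (fun x : ℝ => (x : ℂ)) := by
  have hp0 : p ≠ 0 := by omega
  have hv := omega_pow_mul_dir_pow hp0 k
  ext y
  constructor
  · rintro ⟨z, hz, rfl⟩
    obtain ⟨s, -, rfl⟩ := (mem_V_iff hp k z).1 hz
    exact ⟨_, (f_mul_dir_eq_re hp0 hv s).symm⟩
  · rintro ⟨x, rfl⟩
    have hrot : ∀ s : ℝ, f p (s * (omega p ^ k * dir p)) = f p (s * dir p) := fun s =>
      f_eq_of_pow_eq hp0 (by rw [mul_pow, hv, mul_pow, dir_pow hp0])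
    obtain ⟨⟨s, hs, h1⟩, -⟩ := exists_f_mul_dir_large hp x
    obtain ⟨-, t, ht, h2⟩ := exists_f_mul_dir_large hp (-x)
    rw [neg_neg] at h2
    have hcont : Continuous fun s : ℝ => (f p (s * dir p)).re :=
      continuous_iff_continuousAt.2 fun s => (hasDerivAt_f_mul_dir_re p _ s).continuousAt
    obtain ⟨c, hc, hcx⟩ := intermediate_value_uIcc (a := t) (b := s) hcont.continuousOn
      (Set.mem_uIcc_of_le h2 h1)
    have hc0 : 0 < c := (lt_min ht hs).trans_le hc.1
    refine ⟨c * (omega p ^ k * dir p), (mem_V_iff hp k _).2 ⟨c, hc0, rfl⟩, ?_⟩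
    rw [hrot, f_mul_dir_eq_re hp0 (dir_pow hp0)]
    exact congrArg _ hcx

end ExpSum

/-! ### The main theorem -/

theorem mainTheorem6 (p : ℕ) (hp : 3 ≤ p) :
    -- all critical points lie on the rays (with their common endpoint, the origin)
    (∀ z : ℂ, ExpSum.IsCriticalPoint (ExpSum.f p) z → ∃ k < p, z ∈ ExpSum.closedV p k) ∧
    -- on each ray they are separated from each other by zeros
    (∀ k < p, ∀ a ∈ ExpSum.closedV p k, ∀ b ∈ ExpSum.closedV p k, a ≠ b →
      ExpSum.IsCriticalPoint (ExpSum.f p) a → ExpSum.IsCriticalPoint (ExpSum.f p) b →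
      ∃ c ∈ openSegment ℝ a b, ExpSum.f p c = 0) ∧
    -- each ray is mapped onto the real axis
    (∀ k < p, ExpSum.f p '' ExpSum.V p k = Set.range (fun x : ℝ => (x : ℂ))) ∧
    -- every critical value lies on the positive or the negative real axis
    (∀ v : ℂ, ExpSum.IsCriticalValue (ExpSum.f p) v →
      ∃ x : ℝ, v = (x : ℂ) ∧ x ≠ 0) ∧
    -- along each ray the critical values alternate in sign
    (∀ k < p, ∀ a b : ℂ,
      ExpSum.AreConsecutiveCriticalPoints (ExpSum.f p) (ExpSum.closedV p k) a b →
      (0 < (ExpSum.f p a).re ∧ (ExpSum.f p b).re < 0) ∨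
        ((ExpSum.f p a).re < 0 ∧ 0 < (ExpSum.f p b).re)) := by
  open ExpSum in
  have hp0 : p ≠ 0 := by omega
  simp only [AreConsecutiveCriticalPoints, IsCriticalValue, IsCriticalPoint, deriv_f]
  have loc : ∀ z : ℂ, F p 1 z = 0 → ∃ k < p, z ∈ closedV p k := fun z hz => by
    by_cases h0 : z = 0
    · exact ⟨0, by omega, .inl h0⟩
    obtain ⟨him, hre⟩ := pow_neg_of_F_eq_zero hp0 h0 hz
    obtain ⟨k, hk, hkz⟩ := mem_V_of_pow_neg hp him hre
    exact ⟨k, hk, .inr hkz⟩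
  refine ⟨loc, ?_, fun k _ => f_image_V hp k, ?_, ?_⟩
  · intro k _ a ha b hb hab hFa hFb
    obtain ⟨s, hs, rfl⟩ := (mem_closedV_iff hp k a).1 ha
    obtain ⟨t, ht, rfl⟩ := (mem_closedV_iff hp k b).1 hb
    have hv := omega_pow_mul_dir_pow hp0 k
    have hst : s ≠ t := fun h => hab (by rw [h])
    rcases hst.lt_or_gt with h | h
    · obtain ⟨c, hc, hc0⟩ := exists_zero_between hp0 hv hs h hFa hFb
      exact ⟨_, mem_openSegment_mul hc _, hc0⟩
    · obtain ⟨c, hc, hc0⟩ := exists_zero_between hp0 hv ht h hFb hFa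
      refine ⟨_, ?_, hc0⟩
      rw [openSegment_symm]
      exact mem_openSegment_mul hc _
  · rintro _ ⟨z, hz, rfl⟩
    obtain ⟨k, -, hk⟩ := loc z hz
    obtain ⟨s, -, rfl⟩ := (mem_closedV_iff hp k z).1 hk
    have hreal := f_mul_dir_eq_re hp0 (omega_pow_mul_dir_pow hp0 k) s
    refine ⟨_, hreal, fun h => F_zero_ne_zero_of_F_one_eq_zero hp0 hz ?_⟩
    rw [F_zero, hreal, h, Complex.ofReal_zero]
  · rintro k - a b ⟨ha, hb, hab, hFa, hFb, hne⟩
    obtain ⟨s, hs, rfl⟩ := (mem_closedV_iff hp k a).1 ha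
    obtain ⟨t, ht, rfl⟩ := (mem_closedV_iff hp k b).1 hb
    have hv := omega_pow_mul_dir_pow hp0 k
    have hst : s ≠ t := fun h => hab (by rw [h])
    rcases hst.lt_or_gt with h | h
    · exact sign_change_of_consecutive hp0 hv hs h hFa hFb fun c hc =>
        hne _ (mem_openSegment_mul hc _)
    · have := sign_change_of_consecutive hp0 hv ht h hFb hFa fun c hc =>
        hne _ (by rw [openSegment_symm]; exact mem_openSegment_mul hc _)
      tauto
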